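/- All graphs are simple and undirected, and may be infinite. Let $G=(V,E)$ be a locally finite graph, not necessarily connected, and write $d(\cdot,\cdot)$ for the graph distance (with $d=\infty$ between different components, and $\infty\cdot 0=0$). For a vertex $x$ of degree $d_x\ge 1$ and $\alpha\in[0,1]$ let $\mu_x^\alpha$ be the probability measure with $\mu_x^\alpha(x)=\alpha$, $\mu_x^\alpha(z)=\frac{1-\alpha}{d_x}$ for every neighbour $z$ of $x$, and $\mu_x^\alpha(z)=0$ otherwise. Let $$W(\mu_1,\mu_2)=\inf_{\pi}\sum_{u\in V}\sum_{v\in V}d(u,v)\,\pi(u,v),$$ the infimum over all $\pi:V\times V\to[0,1]$ with $\sum_v\pi(u,v)=\mu_1(u)$ and $\sum_u\pi(u,v)=\mu_2(v)$ for all $u,v$. For adjacent vertices $x,y$ put $$\kappa_\alpha(x,y)=1-\frac{W(\mu_x^\alpha,\mu_y^\alpha)}{d(x,y)},\qquad \kappa_{\rm LLY}(x,y)=\lim_{\alpha\to1^-}\frac{\kappa_\alpha(x,y)}{1-\alpha}.$$ The Cartesian product $G\,\Box\,H$ has vertex set $V(G)\times V(H)$, and $(x_1,y_1)$, $(x_2,y_2)$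 are adjacent if and only if either $x_1=x_2$ and $y_1y_2\in E(H)$, or $y_1=y_2$ and $x_1x_2\in E(G)$. **Theorem.** Let $G$ and $H$ be regular graphs with (finite) vertex degrees $d_G$ and $d_H$. Then $G\,\Box\,H$ is regular with vertex degree $d_{G\Box H}=d_G+d_H$, and for every vertex $x$ of $G$ and all adjacent vertices $y_1,y_2$ of $H$, the limits defining $\kappa_{\rm LLY}(y_1,y_2)$ in $H$ and $\kappa_{\rm LLY}((x,y_1),(x,y_2))$ in $G\,\Box\,H$ exist, and $$\kappa_{\rm LLY}((x,y_1),(x,y_2))=\frac{d_H}{d_G+d_H}\,\kappa_{\rm LLY}(y_1,y_2),\qquad \kappa_0((x,y_1),(x,y_2))=\frac{d_H}{d_G+d_H}\,\kappa_0(y_1,y_2).$$ -/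

import Mathlib

open Filter Topology
open scoped ENNReal

namespace GraphCurvature

noncomputable section

open scoped Classical in
/-- The measure `μ_x^α`: mass `α` at `x`, mass `(1 - α) / d_x` at every neighbour of `x`,
and `0` elsewhere. It is a probability measure when `α ∈ [0, 1]` and `d_x > 0`. -/
def lazyMeasure {V : Type*} (G : SimpleGraph V) [G.LocallyFinite] (α : ℝ) (x : V) : V → ℝ≥0∞ :=
  fun y => if y = x then ENNReal.ofReal α
    else if G.Adj x y then ENNReal.ofReal ((1 - α) / (G.degree x : ℝ))
    else 0

/-- `π` is a transport plan between `μ₁` and `μ₂`: a nonnegative function on `V × V` with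
marginals `μ₁` and `μ₂` (its values are then at most `1` if `μ₁` has total mass `1`). -/
structure IsTransportPlan {V : Type*} (μ₁ μ₂ : V → ℝ≥0∞) (π : V → V → ℝ≥0∞) : Prop where
  fst_marginal : ∀ x, ∑' y, π x y = μ₁ x
  snd_marginal : ∀ y, ∑' x, π x y = μ₂ y

/-- The Wasserstein distance with respect to the graph distance. The extended graph distance is
used, so that vertices of different components are at distance `∞`. -/
def wasserstein {V : Type*} (G : SimpleGraph V) (μ₁ μ₂ : V → ℝ≥0∞) : ℝ≥0∞ :=
  ⨅ (π : V → V → ℝ≥0∞) (_ : IsTransportPlan μ₁ μ₂ π),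
    ∑' x, ∑' y, (G.edist x y : ℝ≥0∞) * π x y

/-- The `α`-Ricci curvature `κ_α(x, y) = 1 - W(μ_x^α, μ_y^α) / d(x, y)`, for distinct vertices
`x`, `y` of the same component (where the Wasserstein distance and `d(x, y)` are finite) and
`α ∈ [0, 1]`. -/
def ricciCurvature {V : Type*} (G : SimpleGraph V) [G.LocallyFinite] (α : ℝ) (x y : V) : ℝ :=
  1 - (wasserstein G (lazyMeasure G α x) (lazyMeasure G α y)).toReal / (G.dist x y : ℝ)

/-- The Lin-Lu-Yau curvature `κ_LLY(x, y)`, the limit of `κ_α(x, y) / (1 - α)` as `α` tends to `1`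
from below. -/
def llyCurvature {V : Type*} (G : SimpleGraph V) [G.LocallyFinite] (x y : V) : ℝ :=
  limUnder (𝓝[<] (1 : ℝ)) (fun α : ℝ => ricciCurvature G α x y / (1 - α))

end

end GraphCurvature

namespace GraphCurvature

/-! Put r = dH / (dG + dH). The β-lazy measure at (x, y) has mass s = β + (1 - β) r on the fibre
over x, where it is s times the lazy measure of H with laziness α = β / s; the remaining mass 1 - s
sits at the points (v, y) with v adjacent to x, the same for y₁ and y₂. The heart is
`wasserstein_fiberMeasure`: an optimal transport may keep the fibre to itself and shift every
outside point along its own edge at cost 1. Hence W = s W_H + (1 - s), that is, κ_β = s κ_α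
(`ricciCurvature_boxProd`).

For β = 0 this gives α = 0 and s = r. For β → 1, the identity s (1 - α) = (1 - β) r turns κ_β / (1 -
β) into r κ_α / (1 - α) with α → 1. The limits exist because κ_α / (1 - α) is monotone
(`mul_ricciCurvature_le`) and at most 2 (`ricciCurvature_le`). -/

open scoped Classical in
/-- The indicator function of the complement of the fibre over `x` in `V × W`. -/
noncomputable def offFiber {V W : Type*} (x : V) (P : V × W) : ℝ≥0∞ := if P.1 = x then 0 else 1

open scoped Classical in
/-- The measure on `V × W` that is `ν` on the fibre over `x`, and `b` on the rest of the layer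
at height `y`. -/
noncomputable def fiberMeasure {V W : Type*} (x : V) (ν : W → ℝ≥0∞) (b : V → ℝ≥0∞) (y : W) :
    V × W → ℝ≥0∞ :=
  fun P => if P.1 = x then ν P.2 else if P.2 = y then b P.1 else 0

/-- The total cost of a transport plan. -/
noncomputable def transportCost {V : Type*} (G : SimpleGraph V) (π : V → V → ℝ≥0∞) : ℝ≥0∞ :=
  ∑' x, ∑' y, (G.edist x y : ℝ≥0∞) * π x y

variable {V W : Type*}

lemma wasserstein_le_transportCost {G : SimpleGraph V} {μ₁ μ₂ : V → ℝ≥0∞} {π : V → V → ℝ≥0∞}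
    (h : IsTransportPlan μ₁ μ₂ π) : wasserstein G μ₁ μ₂ ≤ transportCost G π :=
  iInf₂_le (f := fun π (_ : IsTransportPlan μ₁ μ₂ π) =>
    ∑' x, ∑' y, (G.edist x y : ℝ≥0∞) * π x y) π h

lemma le_wasserstein {G : SimpleGraph V} {μ₁ μ₂ : V → ℝ≥0∞} {c : ℝ≥0∞}
    (h : ∀ π, IsTransportPlan μ₁ μ₂ π → c ≤ transportCost G π) : c ≤ wasserstein G μ₁ μ₂ :=
  le_iInf₂ h

lemma edist_triangle_ennreal (G : SimpleGraph V) (u v w : V) :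
    (G.edist u w : ℝ≥0∞) ≤ G.edist u v + G.edist v w := by
  rw [← ENat.toENNReal_add, ENat.toENNReal_le]
  exact SimpleGraph.edist_triangle

lemma one_le_edist_of_ne (G : SimpleGraph V) {u v : V} (h : u ≠ v) :
    (1 : ℝ≥0∞) ≤ G.edist u v := by
  rw [← ENat.toENNReal_one, ENat.toENNReal_le]
  exact Order.one_le_iff_pos.2 (SimpleGraph.edist_pos_of_ne h)

lemma edist_eq_one_ennreal (G : SimpleGraph V) {u v : V} (h : G.Adj u v) :
    (G.edist u v : ℝ≥0∞) = 1 := by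
  rw [SimpleGraph.edist_eq_one_iff_adj.2 h, ENat.toENNReal_one]

/-! ### Splitting sums along a fibre -/

lemma tsum_prod_fiber (x : V) (F : V × W → ℝ≥0∞) :
    ∑' P, F P = ∑' a, F (x, a) + ∑' P, offFiber x P * F P := by
  classical
  rw [ENNReal.tsum_prod', ENNReal.tsum_eq_add_tsum_ite x]
  congr 1
  rw [ENNReal.tsum_prod']
  refine tsum_congr fun v => ?_
  by_cases h : v = x <;> simp [offFiber, h]

lemma tsum_offFiber_mul_fiberMeasure (x : V) (ν : W → ℝ≥0∞) (b : V → ℝ≥0∞) (hb : b x = 0) (y : W) :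
    ∑' P, offFiber x P * fiberMeasure x ν b y P = ∑' v, b v := by
  classical
  rw [ENNReal.tsum_prod']
  refine tsum_congr fun v => ?_
  by_cases h : v = x
  · simp [offFiber, h, hb]
  · rw [tsum_eq_single y]
    · simp [offFiber, fiberMeasure, h]
    · intro w hw
      simp [fiberMeasure, h, hw]

/-- For a plan, the four blocks are the mass staying in the fibre, leaving it, entering it, and
staying outside. -/
lemma tsum_tsum_fiber (x : V) (F : V × W → V × W → ℝ≥0∞) :
    ∑' P, ∑' Q, F P Q = ∑' a, ∑' b, F (x, a) (x, b) + ∑' a, ∑' Q, offFiber x Q * F (x, a) Q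
      + ∑' b, ∑' P, offFiber x P * F P (x, b)
      + ∑' P, offFiber x P * ∑' Q, offFiber x Q * F P Q := by
  have h (P : V × W) : ∑' Q, F P Q = ∑' a, F P (x, a) + ∑' Q, offFiber x Q * F P Q :=
    tsum_prod_fiber x (F P)
  rw [tsum_prod_fiber x]
  have h' : ∑' b, ∑' P, offFiber x P * F P (x, b) = ∑' P, offFiber x P * ∑' b, F P (x, b) := by
    rw [ENNReal.tsum_comm]
    exact tsum_congr fun P => ENNReal.tsum_mul_left
  simp_rw [h, mul_add]
  rw [ENNReal.tsum_add, ENNReal.tsum_add, h']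
  simp only [add_assoc]

lemma offFiber_mul_le {x : V} {P : V × W} {s t : ℝ≥0∞} (h : P.1 ≠ x → s ≤ t) :
    offFiber x P * s ≤ offFiber x P * t := by
  by_cases hP : P.1 = x
  · simp [offFiber, hP]
  · gcongr
    exact h hP

lemma IsTransportPlan.eq_zero_of_fst {μ₁ μ₂ : V → ℝ≥0∞} {π : V → V → ℝ≥0∞}
    (h : IsTransportPlan μ₁ μ₂ π) {u : V} (hu : μ₁ u = 0) (v : V) : π u v = 0 :=
  ENNReal.tsum_eq_zero.1 ((h.fst_marginal u).trans hu) v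

lemma IsTransportPlan.eq_zero_of_snd {μ₁ μ₂ : V → ℝ≥0∞} {π : V → V → ℝ≥0∞}
    (h : IsTransportPlan μ₁ μ₂ π) {v : V} (hv : μ₂ v = 0) (u : V) : π u v = 0 :=
  ENNReal.tsum_eq_zero.1 ((h.snd_marginal v).trans hv) u

/-! ### Transport between fibre measures -/

lemma wasserstein_fiberMeasure_le (G : SimpleGraph V) (H : SimpleGraph W) (x : V)
    (ν₁ ν₂ : W → ℝ≥0∞) (b : V → ℝ≥0∞) (hb : b x = 0) {y₁ y₂ : W} (hy : H.Adj y₁ y₂) :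
    wasserstein (SimpleGraph.boxProd G H) (fiberMeasure x ν₁ b y₁) (fiberMeasure x ν₂ b y₂) ≤
      wasserstein H ν₁ ν₂ + ∑' v, b v := by
  classical
  rw [← tsub_le_iff_right]
  refine le_wasserstein fun ρ hρ => ?_
  rw [tsub_le_iff_right]
  -- Copy `ρ` inside the fibre; outside, send (v, y₁) to (v, y₂) across one edge.
  let σ : V × W → V × W → ℝ≥0∞ := fun P Q =>
    if P.1 = x then (if Q.1 = x then ρ P.2 Q.2 else 0)
    else if P.1 = Q.1 ∧ P.2 = y₁ ∧ Q.2 = y₂ then b P.1 else 0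
  have hσ : IsTransportPlan (fiberMeasure x ν₁ b y₁) (fiberMeasure x ν₂ b y₂) σ := by
    constructor
    · rintro ⟨u, a⟩
      by_cases hu : u = x
      · subst hu
        rw [tsum_prod_fiber u]
        have : ∀ Q : V × W, offFiber u Q * σ (u, a) Q = 0 := by
          intro Q
          by_cases hQ : Q.1 = u <;> simp [offFiber, σ, hQ]
        simp only [this, tsum_zero]
        simp [σ, fiberMeasure, hρ.fst_marginal]
      · rw [tsum_eq_single (u, y₂)]
        · simp [σ, fiberMeasure, hu]
        · rintro ⟨v, c⟩ hv
          simp only [σ, hu, if_false]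
          rw [if_neg]
          rintro ⟨rfl, -, rfl⟩
          exact hv rfl
    · rintro ⟨v, c⟩
      by_cases hv : v = x
      · subst hv
        rw [tsum_prod_fiber v]
        have : ∀ P : V × W, offFiber v P * σ P (v, c) = 0 := by
          intro P
          by_cases hP : P.1 = v <;> simp [offFiber, σ, hP]
        simp only [this, tsum_zero]
        simp [σ, fiberMeasure, hρ.snd_marginal]
      · rw [tsum_eq_single (v, y₁)]
        · simp [σ, fiberMeasure, hv]
        · rintro ⟨u, a⟩ hu
          simp only [σ]
          by_cases hux : u = x
          · simp [hux, hv]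
          · rw [if_neg hux, if_neg]
            rintro ⟨rfl, rfl, -⟩
            exact hu rfl
  refine (wasserstein_le_transportCost hσ).trans (le_of_eq ?_)
  unfold transportCost
  rw [tsum_tsum_fiber x]
  have h2 : ∀ (a : W) (Q : V × W), offFiber x Q *
      (((SimpleGraph.boxProd G H).edist (x, a) Q : ℝ≥0∞) * σ (x, a) Q) = 0 := by
    intro a Q
    by_cases hQ : Q.1 = x <;> simp [offFiber, σ, hQ]
  have h3 : ∀ (a : W) (P : V × W), offFiber x P *
      (((SimpleGraph.boxProd G H).edist P (x, a) : ℝ≥0∞) * σ P (x, a)) = 0 := by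
    intro a P
    by_cases hP : P.1 = x <;> simp [offFiber, σ, hP]
  have h4 : ∀ P : V × W, offFiber x P * ∑' Q, offFiber x Q *
      (((SimpleGraph.boxProd G H).edist P Q : ℝ≥0∞) * σ P Q) =
      offFiber x P * fiberMeasure x ν₁ b y₁ P := by
    rintro ⟨u, a⟩
    by_cases hu : u = x
    · simp [offFiber, hu]
    · rw [tsum_eq_single (u, y₂)]
      · by_cases ha : a = y₁
        · subst ha
          simp [σ, fiberMeasure, hu, offFiber, edist_eq_one_ennreal H hy]
        · simp [σ, fiberMeasure, hu, ha]
      · rintro ⟨v, c⟩ hv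
        simp only [σ, hu, if_false]
        rw [if_neg]
        · simp
        · rintro ⟨rfl, -, rfl⟩
          exact hv rfl
  simp only [h2, h3, h4, tsum_zero, add_zero, tsum_offFiber_mul_fiberMeasure x ν₁ b hb]
  simp [σ]

/-- Any plan can be rerouted to respect the fibre. Mass leaving it at a ends at height y₂ and costs
at least 1 + d(a, y₂); mass entering at c comes from height y₁ and costs at least 1 + d(y₁, c). Both
have total m. Pairing them inside the fibre along a, y₂, y₁, c costs d(a, y₂) + 1 + d(y₁, c), and
the saved unit per pair pays for shifting the outside mass. -/
lemma le_wasserstein_fiberMeasure (G : SimpleGraph V) (H : SimpleGraph W) (x : V)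
    (ν₁ ν₂ : W → ℝ≥0∞) (b : V → ℝ≥0∞) (hb : b x = 0) (hfin : ∑' v, b v ≠ ⊤) {y₁ y₂ : W}
    (hy : H.Adj y₁ y₂) :
    wasserstein H ν₁ ν₂ + ∑' v, b v ≤
      wasserstein (SimpleGraph.boxProd G H) (fiberMeasure x ν₁ b y₁)
        (fiberMeasure x ν₂ b y₂) := by
  classical
  refine le_wasserstein fun π hπ => ?_
  set d : W → W → ℝ≥0∞ := fun a c => (H.edist a c : ℝ≥0∞) with hd
  set p : W → ℝ≥0∞ := fun a => ∑' Q, offFiber x Q * π (x, a) Q with hp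
  set q : W → ℝ≥0∞ := fun c => ∑' P, offFiber x P * π P (x, c) with hq
  set o : ℝ≥0∞ := ∑' P, offFiber x P * ∑' Q, offFiber x Q * π P Q with ho
  set m : ℝ≥0∞ := ∑' a, p a with hm
  have hmarg₁ (a : W) : ∑' c, π (x, a) (x, c) + p a = ν₁ a := by
    rw [hp, ← tsum_prod_fiber x, hπ.fst_marginal]
    simp [fiberMeasure]
  have hmarg₂ (c : W) : ∑' a, π (x, a) (x, c) + q c = ν₂ c := by
    rw [hq, ← tsum_prod_fiber x (fun P => π P (x, c)), hπ.snd_marginal]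
    simp [fiberMeasure]
  have hqo : ∑' c, q c + o = ∑' v, b v := by
    rw [← tsum_offFiber_mul_fiberMeasure x ν₁ b hb y₁, hq, ho, ENNReal.tsum_comm,
      ← ENNReal.tsum_add]
    refine tsum_congr fun P => ?_
    rw [← hπ.fst_marginal, tsum_prod_fiber x (π P), mul_add, ENNReal.tsum_mul_left]
  have hpo : m + o = ∑' v, b v := by
    have ho' : o = ∑' Q, offFiber x Q * ∑' P, offFiber x P * π P Q := by
      simp_rw [ho, ← ENNReal.tsum_mul_left]
      rw [ENNReal.tsum_comm]
      simp_rw [mul_left_comm]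
    rw [← tsum_offFiber_mul_fiberMeasure x ν₂ b hb y₂, hm, hp, ho', ENNReal.tsum_comm,
      ← ENNReal.tsum_add]
    refine tsum_congr fun P => ?_
    rw [← hπ.snd_marginal, tsum_prod_fiber x (fun Q => π Q P), mul_add, ENNReal.tsum_mul_left]
  have ho_top : o ≠ ⊤ := ne_top_of_le_ne_top hfin (hpo ▸ le_add_self)
  have hm_top : m ≠ ⊤ := ne_top_of_le_ne_top hfin (hpo ▸ le_self_add)
  have hmq : ∑' c, q c = m := by
    rw [← ENNReal.add_left_inj ho_top, hqo, hpo]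
  -- This form covers m = 0, where m * m⁻¹ = 0 but s vanishes too.
  have hcancel {s : ℝ≥0∞} (hs : s ≤ m) : s * (m * m⁻¹) = s := by
    rcases eq_or_ne m 0 with h0 | h0
    · simp [le_zero_iff.1 (h0 ▸ hs)]
    · rw [ENNReal.mul_inv_cancel h0 hm_top, mul_one]
  -- Leaving and entering mass are coupled independently, normalised by their common total.
  let ρ : W → W → ℝ≥0∞ := fun a c => π (x, a) (x, c) + p a * q c * m⁻¹
  have hρ : IsTransportPlan ν₁ ν₂ ρ := by
    constructor
    · intro a
      rw [ENNReal.tsum_add, ENNReal.tsum_mul_right, ENNReal.tsum_mul_left, hmq, mul_assoc,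
        hcancel (ENNReal.le_tsum a), hmarg₁]
    · intro c
      rw [ENNReal.tsum_add, ENNReal.tsum_mul_right, ENNReal.tsum_mul_right, ← hm, mul_comm m,
        mul_assoc, hcancel (hmq ▸ ENNReal.le_tsum c), hmarg₂]
  have hcostρ : transportCost H ρ ≤ ∑' a, ∑' c, d a c * π (x, a) (x, c) +
      (∑' a, d a y₂ * p a + m + ∑' c, d y₁ c * q c) := by
    have hterm (a c : W) : d a c * ρ a c ≤ d a c * π (x, a) (x, c) +
        ((d a y₂ * p a) * (q c * m⁻¹) + p a * (q c * m⁻¹) +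
          (p a * m⁻¹) * (d y₁ c * q c)) := by
      have h1 : d a c ≤ d a y₂ + 1 + d y₁ c := by
        have h2 := edist_triangle_ennreal H a y₂ c
        have h3 := edist_triangle_ennreal H y₂ y₁ c
        rw [edist_eq_one_ennreal H hy.symm] at h3
        calc d a c ≤ d a y₂ + (1 + d y₁ c) := h2.trans (by gcongr)
          _ = _ := by ring
      calc d a c * ρ a c = d a c * π (x, a) (x, c) + d a c * (p a * q c * m⁻¹) := mul_add _ _ _
        _ ≤ d a c * π (x, a) (x, c) + (d a y₂ + 1 + d y₁ c) * (p a * q c * m⁻¹) := by gcongr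
        _ = _ := by ring
    have hdp (a : W) : d a y₂ * p a * (m * m⁻¹) = d a y₂ * p a := by
      rw [mul_assoc, hcancel (ENNReal.le_tsum a)]
    have hdq (c : W) : m * m⁻¹ * (d y₁ c * q c) = d y₁ c * q c := by
      rw [mul_comm, mul_assoc, hcancel (hmq ▸ ENNReal.le_tsum c)]
    refine (ENNReal.tsum_le_tsum fun a => ENNReal.tsum_le_tsum (hterm a)).trans (le_of_eq ?_)
    simp_rw [ENNReal.tsum_add, ENNReal.tsum_mul_left, ENNReal.tsum_mul_right, hmq, ← hm]
    congr 2
    · congr 1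
      · rw [← ENNReal.tsum_mul_right]
        exact tsum_congr hdp
      · exact hcancel le_rfl
    · rw [← ENNReal.tsum_mul_left]
      exact tsum_congr hdq
  have hcostπ : ∑' a, ∑' c, d a c * π (x, a) (x, c) + ∑' a, (1 + d a y₂) * p a +
      ∑' c, (1 + d y₁ c) * q c + o ≤ transportCost (SimpleGraph.boxProd G H) π := by
    unfold transportCost
    rw [tsum_tsum_fiber x]
    gcongr ?_ + ?_ + ?_ + ?_
    · simp [hd]
    · refine ENNReal.tsum_le_tsum fun a => ?_
      rw [← ENNReal.tsum_mul_left]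
      refine ENNReal.tsum_le_tsum fun Q => ?_
      rw [mul_left_comm]
      refine offFiber_mul_le fun hQ => ?_
      by_cases hQ2 : Q.2 = y₂
      · rw [SimpleGraph.edist_boxProd, ENat.toENNReal_add, hQ2]
        gcongr
        exact one_le_edist_of_ne G hQ.symm
      · rw [hπ.eq_zero_of_snd (by simp [fiberMeasure, hQ, hQ2])]
        simp
    · refine ENNReal.tsum_le_tsum fun c => ?_
      rw [← ENNReal.tsum_mul_left]
      refine ENNReal.tsum_le_tsum fun P => ?_
      rw [mul_left_comm]
      refine offFiber_mul_le fun hP => ?_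
      by_cases hP2 : P.2 = y₁
      · rw [SimpleGraph.edist_boxProd, ENat.toENNReal_add, hP2]
        gcongr
        exact one_le_edist_of_ne G hP
      · rw [hπ.eq_zero_of_fst (by simp [fiberMeasure, hP, hP2])]
        simp
    · refine ENNReal.tsum_le_tsum fun P => ?_
      refine offFiber_mul_le fun hP => ?_
      refine ENNReal.tsum_le_tsum fun Q => ?_
      refine offFiber_mul_le fun hQ => ?_
      by_cases hP2 : P.2 = y₁
      · by_cases hQ2 : Q.2 = y₂
        · rw [SimpleGraph.edist_boxProd, ENat.toENNReal_add, hP2, hQ2,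
            edist_eq_one_ennreal H hy, add_mul, one_mul]
          exact le_add_self
        · rw [hπ.eq_zero_of_snd (by simp [fiberMeasure, hQ, hQ2])]
          simp
      · rw [hπ.eq_zero_of_fst (by simp [fiberMeasure, hP, hP2])]
        simp
  calc wasserstein H ν₁ ν₂ + ∑' v, b v ≤ transportCost H ρ + (m + o) := by
        rw [hpo]
        gcongr
        exact wasserstein_le_transportCost hρ
    _ ≤ ∑' a, ∑' c, d a c * π (x, a) (x, c) +
          (∑' a, d a y₂ * p a + m + ∑' c, d y₁ c * q c) + (m + o) := by gcongr
    _ = ∑' a, ∑' c, d a c * π (x, a) (x, c) + ∑' a, (1 + d a y₂) * p a +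
          ∑' c, (1 + d y₁ c) * q c + o := by
        simp_rw [add_mul, one_mul, ENNReal.tsum_add, hmq, ← hm]
        ring
    _ ≤ _ := hcostπ

theorem wasserstein_fiberMeasure (G : SimpleGraph V) (H : SimpleGraph W) (x : V)
    (ν₁ ν₂ : W → ℝ≥0∞) (b : V → ℝ≥0∞) (hb : b x = 0) (hfin : ∑' v, b v ≠ ⊤) {y₁ y₂ : W}
    (hy : H.Adj y₁ y₂) :
    wasserstein (SimpleGraph.boxProd G H) (fiberMeasure x ν₁ b y₁) (fiberMeasure x ν₂ b y₂) =
      wasserstein H ν₁ ν₂ + ∑' v, b v :=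
  (wasserstein_fiberMeasure_le G H x ν₁ ν₂ b hb hy).antisymm
    (le_wasserstein_fiberMeasure G H x ν₁ ν₂ b hb hfin hy)

/-! ### Scaling of the Wasserstein distance -/

lemma transportCost_const_mul (G : SimpleGraph V) (c : ℝ≥0∞) (π : V → V → ℝ≥0∞) :
    transportCost G (fun u v => c * π u v) = c * transportCost G π := by
  simp_rw [transportCost, mul_left_comm _ c, ENNReal.tsum_mul_left]

lemma transportCost_add (G : SimpleGraph V) (π σ : V → V → ℝ≥0∞) :
    transportCost G (fun u v => π u v + σ u v) = transportCost G π + transportCost G σ := by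
  simp_rw [transportCost, mul_add, ENNReal.tsum_add]

lemma inv_mul_wasserstein_const_mul_le (G : SimpleGraph V) {c : ℝ≥0∞} (h0 : c ≠ 0) (ht : c ≠ ⊤)
    (μ₁ μ₂ : V → ℝ≥0∞) :
    c⁻¹ * wasserstein G (fun v => c * μ₁ v) (fun v => c * μ₂ v) ≤ wasserstein G μ₁ μ₂ := by
  refine le_wasserstein fun π hπ => ?_
  rw [ENNReal.inv_mul_le_iff h0 ht, ← transportCost_const_mul]
  refine wasserstein_le_transportCost ⟨fun u => ?_, fun v => ?_⟩
  · rw [ENNReal.tsum_mul_left, hπ.fst_marginal]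
  · rw [ENNReal.tsum_mul_left, hπ.snd_marginal]

lemma wasserstein_const_mul (G : SimpleGraph V) {c : ℝ≥0∞} (h0 : c ≠ 0) (ht : c ≠ ⊤)
    (μ₁ μ₂ : V → ℝ≥0∞) :
    wasserstein G (fun v => c * μ₁ v) (fun v => c * μ₂ v) = c * wasserstein G μ₁ μ₂ := by
  apply le_antisymm
  · rw [← ENNReal.inv_mul_le_iff h0 ht]
    exact inv_mul_wasserstein_const_mul_le G h0 ht μ₁ μ₂
  · have h := inv_mul_wasserstein_const_mul_le G (ENNReal.inv_ne_zero.2 ht)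
      (ENNReal.inv_ne_top.2 h0) (fun v => c * μ₁ v) (fun v => c * μ₂ v)
    simpa only [inv_inv, ← mul_assoc, ENNReal.inv_mul_cancel h0 ht, one_mul] using h

/-! ### Lazy measures and existence of the Lin-Lu-Yau limit -/

lemma tsum_ite_adj (G : SimpleGraph V) [G.LocallyFinite] [DecidableRel G.Adj] (x : V)
    (f : V → ℝ≥0∞) :
    ∑' v, (if G.Adj x v then f v else 0) = ∑ v ∈ G.neighborFinset x, f v := by
  rw [tsum_eq_sum (s := G.neighborFinset x)]
  · exact Finset.sum_congr rfl fun v hv => if_pos ((G.mem_neighborFinset x v).1 hv)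
  · exact fun v hv => if_neg fun h => hv ((G.mem_neighborFinset x v).2 h)

lemma tsum_mul_lazyMeasure (G : SimpleGraph V) [G.LocallyFinite] (α : ℝ) (x : V)
    (f : V → ℝ≥0∞) :
    ∑' v, f v * lazyMeasure G α x v = f x * ENNReal.ofReal α +
      ∑ v ∈ G.neighborFinset x, f v * ENNReal.ofReal ((1 - α) / (G.degree x : ℝ)) := by
  classical
  rw [← tsum_ite_adj, ENNReal.tsum_eq_add_tsum_ite x]
  congr 1
  · simp [lazyMeasure]
  · refine tsum_congr fun v => ?_
    by_cases hv : v = x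
    · simp [hv]
    · simp [lazyMeasure, hv]

lemma degree_mul_ofReal_div {n : ℕ} (hn : 0 < n) (a : ℝ) :
    (n : ℝ≥0∞) * ENNReal.ofReal (a / (n : ℝ)) = ENNReal.ofReal a := by
  rw [← ENNReal.ofReal_natCast, ← ENNReal.ofReal_mul (Nat.cast_nonneg n)]
  congr 1
  field_simp

lemma tsum_lazyMeasure (G : SimpleGraph V) [G.LocallyFinite] {α : ℝ} (h0 : 0 ≤ α) (h1 : α ≤ 1)
    {x : V} (hx : 0 < G.degree x) : ∑' v, lazyMeasure G α x v = 1 := by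
  have h := tsum_mul_lazyMeasure G α x 1
  simp only [Pi.one_apply, one_mul, Finset.sum_const, SimpleGraph.card_neighborFinset_eq_degree,
    nsmul_eq_mul, degree_mul_ofReal_div hx] at h
  rw [h, ← ENNReal.ofReal_add h0 (sub_nonneg.2 h1)]
  simp

lemma edist_mul_lazyMeasure_le (G : SimpleGraph V) [G.LocallyFinite] (α : ℝ) (x v : V) :
    (G.edist x v : ℝ≥0∞) * lazyMeasure G α x v ≤ lazyMeasure G α x v := by
  classical
  by_cases hv : v = x
  · simp [hv]
  · by_cases ha : G.Adj x v
    · simp [edist_eq_one_ennreal G ha]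
    · simp [lazyMeasure, hv, ha]

/-- The product plan costs at most 3, since points of the two supports are joined through x and y.
-/
lemma wasserstein_lazyMeasure_ne_top (G : SimpleGraph V) [G.LocallyFinite] {α : ℝ} (h0 : 0 ≤ α)
    (h1 : α ≤ 1) {x y : V} (hxy : G.Adj x y) :
    wasserstein G (lazyMeasure G α x) (lazyMeasure G α y) ≠ ⊤ := by
  have hμ := tsum_lazyMeasure G h0 h1 hxy.degree_pos_left
  have hν := tsum_lazyMeasure G h0 h1 hxy.degree_pos_right
  set μ := lazyMeasure G α x
  set ν := lazyMeasure G α y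
  have hplan : IsTransportPlan μ ν fun u v => μ u * ν v :=
    ⟨fun u => by rw [ENNReal.tsum_mul_left, hν, mul_one],
      fun v => by rw [ENNReal.tsum_mul_right, hμ, one_mul]⟩
  refine ne_top_of_le_ne_top (b := 3) (by simp) ((wasserstein_le_transportCost hplan).trans ?_)
  calc transportCost G (fun u v => μ u * ν v) ≤ ∑' u, ∑' v, 3 * (μ u * ν v) := by
        refine ENNReal.tsum_le_tsum fun u => ENNReal.tsum_le_tsum fun v => ?_
        have hu : (G.edist x u : ℝ≥0∞) * μ u ≤ μ u := edist_mul_lazyMeasure_le G α x u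
        have hv : (G.edist y v : ℝ≥0∞) * ν v ≤ ν v := edist_mul_lazyMeasure_le G α y v
        have ht : (G.edist u v : ℝ≥0∞) ≤ G.edist x u + (1 + G.edist y v) := by
          refine (edist_triangle_ennreal G u x v).trans ?_
          rw [SimpleGraph.edist_comm (u := u)]
          gcongr
          rw [← edist_eq_one_ennreal G hxy]
          exact edist_triangle_ennreal G x y v
        calc (G.edist u v : ℝ≥0∞) * (μ u * ν v)
            ≤ (G.edist x u + (1 + G.edist y v)) * (μ u * ν v) := by gcongr
          _ = (G.edist x u * μ u) * ν v + μ u * ν v + μ u * (G.edist y v * ν v) := by ring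
          _ ≤ μ u * ν v + μ u * ν v + μ u * ν v := by gcongr
          _ = 3 * (μ u * ν v) := by ring
    _ = 3 := by simp_rw [ENNReal.tsum_mul_left, hν, mul_one, hμ, mul_one]

/-- Duality with the 1-Lipschitz function d(·, y): its integral is at least α against the measure at
x, and 1 - α against the measure at y. -/
lemma ofReal_le_wasserstein_lazyMeasure (G : SimpleGraph V) [G.LocallyFinite] {α : ℝ}
    {x y : V} (hxy : G.Adj x y) :
    ENNReal.ofReal α ≤
      wasserstein G (lazyMeasure G α x) (lazyMeasure G α y) + ENNReal.ofReal (1 - α) := by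
  rw [← tsub_le_iff_right]
  refine le_wasserstein fun π hπ => ?_
  rw [tsub_le_iff_right]
  calc ENNReal.ofReal α ≤ ∑' u, (G.edist u y : ℝ≥0∞) * lazyMeasure G α x u := by
        rw [tsum_mul_lazyMeasure, edist_eq_one_ennreal G hxy, one_mul]
        exact le_self_add
    _ = ∑' u, ∑' v, (G.edist u y : ℝ≥0∞) * π u v := by
        simp_rw [← hπ.fst_marginal, ENNReal.tsum_mul_left]
    _ ≤ ∑' u, ∑' v, ((G.edist u v : ℝ≥0∞) * π u v + (G.edist v y : ℝ≥0∞) * π u v) := by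
        refine ENNReal.tsum_le_tsum fun u => ENNReal.tsum_le_tsum fun v => ?_
        rw [← add_mul]
        gcongr
        exact edist_triangle_ennreal G u v y
    _ = transportCost G π + ∑' v, (G.edist v y : ℝ≥0∞) * lazyMeasure G α y v := by
        simp_rw [ENNReal.tsum_add]
        rw [ENNReal.tsum_comm (f := fun u v => (G.edist v y : ℝ≥0∞) * π u v)]
        simp_rw [ENNReal.tsum_mul_left, hπ.snd_marginal]
        rfl
    _ = transportCost G π + ENNReal.ofReal (1 - α) := by
        rw [tsum_mul_lazyMeasure, SimpleGraph.edist_self, Finset.sum_congr rfl fun v hv =>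
          congrArg (· * _) (edist_eq_one_ennreal G ((G.mem_neighborFinset y v).1 hv).symm)]
        simp [degree_mul_ofReal_div hxy.degree_pos_right]

open scoped Classical in
lemma lazyMeasure_eq_convex_combination (G : SimpleGraph V) [G.LocallyFinite] {α β t : ℝ}
    (hα : 0 ≤ α) (ht0 : 0 ≤ t) (ht1 : t ≤ 1) (h : 1 - β = t * (1 - α)) (x v : V) :
    lazyMeasure G β x v = ENNReal.ofReal t * lazyMeasure G α x v +
      ENNReal.ofReal (1 - t) * (if v = x then 1 else 0) := by
  by_cases hv : v = x
  · simp only [lazyMeasure, hv, if_true, mul_one]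
    rw [← ENNReal.ofReal_mul ht0, ← ENNReal.ofReal_add (by positivity) (sub_nonneg.2 ht1)]
    congr 1
    linarith
  · by_cases ha : G.Adj x v
    · simp [lazyMeasure, hv, ha, h, ← ENNReal.ofReal_mul ht0, mul_div_assoc]
    · simp [lazyMeasure, hv, ha]

/-- The β-lazy measures are mixtures of the α-lazy ones and point masses, so plans mix too; moving
the point mass from x to y costs 1. -/
lemma wasserstein_lazyMeasure_le (G : SimpleGraph V) [G.LocallyFinite] {α β t : ℝ}
    (hα : 0 ≤ α) (ht0 : 0 < t) (ht1 : t ≤ 1) (h : 1 - β = t * (1 - α)) {x y : V}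
    (hxy : G.Adj x y) :
    wasserstein G (lazyMeasure G β x) (lazyMeasure G β y) ≤
      ENNReal.ofReal t * wasserstein G (lazyMeasure G α x) (lazyMeasure G α y) +
        ENNReal.ofReal (1 - t) := by
  classical
  have hc0 : ENNReal.ofReal t ≠ 0 := by simpa using ht0
  rw [← tsub_le_iff_right, ← ENNReal.inv_mul_le_iff hc0 ENNReal.ofReal_ne_top]
  refine le_wasserstein fun π hπ => ?_
  rw [ENNReal.inv_mul_le_iff hc0 ENNReal.ofReal_ne_top, tsub_le_iff_right]
  let σ : V → V → ℝ≥0∞ := fun u v => if u = x then if v = y then 1 else 0 else 0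
  have hσ : transportCost G σ = 1 := by
    unfold transportCost
    rw [tsum_eq_single x fun u hu => by simp [σ, hu],
      tsum_eq_single y fun v hv => by simp [σ, hv]]
    simp [σ, edist_eq_one_ennreal G hxy]
  have hplan : IsTransportPlan (lazyMeasure G β x) (lazyMeasure G β y)
      fun u v => ENNReal.ofReal t * π u v + ENNReal.ofReal (1 - t) * σ u v := by
    constructor
    · intro u
      rw [ENNReal.tsum_add, ENNReal.tsum_mul_left, ENNReal.tsum_mul_left, hπ.fst_marginal,
        lazyMeasure_eq_convex_combination G hα ht0.le ht1 h]
      by_cases hu : u = x <;> simp [σ, hu]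
    · intro v
      rw [ENNReal.tsum_add, ENNReal.tsum_mul_left, ENNReal.tsum_mul_left, hπ.snd_marginal,
        lazyMeasure_eq_convex_combination G hα ht0.le ht1 h]
      by_cases hv : v = y <;> simp [σ, hv]
  refine (wasserstein_le_transportCost hplan).trans_eq ?_
  rw [transportCost_add, transportCost_const_mul, transportCost_const_mul, hσ, mul_one]

lemma ricciCurvature_of_adj (G : SimpleGraph V) [G.LocallyFinite] (α : ℝ) {x y : V}
    (hxy : G.Adj x y) :
    ricciCurvature G α x y =
      1 - (wasserstein G (lazyMeasure G α x) (lazyMeasure G α y)).toReal := by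
  simp [ricciCurvature, SimpleGraph.dist_eq_one_iff_adj.2 hxy]

/-- With t = (1 - β) / (1 - α) this is the monotonicity of κ_α / (1 - α) in α. -/
lemma mul_ricciCurvature_le (G : SimpleGraph V) [G.LocallyFinite] {α β t : ℝ}
    (hα : 0 ≤ α) (hα1 : α ≤ 1) (ht0 : 0 < t) (ht1 : t ≤ 1) (h : 1 - β = t * (1 - α)) {x y : V}
    (hxy : G.Adj x y) : t * ricciCurvature G α x y ≤ ricciCurvature G β x y := by
  have hW := wasserstein_lazyMeasure_ne_top G hα hα1 hxy
  have hle := ENNReal.toReal_mono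
    (ENNReal.add_ne_top.2 ⟨ENNReal.mul_ne_top ENNReal.ofReal_ne_top hW, ENNReal.ofReal_ne_top⟩)
    (wasserstein_lazyMeasure_le G hα ht0 ht1 h hxy)
  rw [ENNReal.toReal_add (ENNReal.mul_ne_top ENNReal.ofReal_ne_top hW) ENNReal.ofReal_ne_top,
    ENNReal.toReal_mul, ENNReal.toReal_ofReal ht0.le,
    ENNReal.toReal_ofReal (sub_nonneg.2 ht1)] at hle
  rw [ricciCurvature_of_adj G α hxy, ricciCurvature_of_adj G β hxy]
  linarith

lemma ricciCurvature_le (G : SimpleGraph V) [G.LocallyFinite] {α : ℝ}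
    (hα : 0 ≤ α) (hα1 : α ≤ 1) {x y : V} (hxy : G.Adj x y) :
    ricciCurvature G α x y ≤ 2 * (1 - α) := by
  have hW := wasserstein_lazyMeasure_ne_top G hα hα1 hxy
  have hle := ENNReal.toReal_mono (ENNReal.add_ne_top.2 ⟨hW, ENNReal.ofReal_ne_top⟩)
    (ofReal_le_wasserstein_lazyMeasure G (α := α) hxy)
  rw [ENNReal.toReal_add hW ENNReal.ofReal_ne_top, ENNReal.toReal_ofReal hα,
    ENNReal.toReal_ofReal (sub_nonneg.2 hα1)] at hle
  rw [ricciCurvature_of_adj G α hxy]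
  linarith

/-- The limit defining the Lin-Lu-Yau curvature of an edge exists. -/
theorem tendsto_llyCurvature (G : SimpleGraph V) [G.LocallyFinite] {x y : V} (hxy : G.Adj x y) :
    Tendsto (fun α : ℝ => ricciCurvature G α x y / (1 - α)) (𝓝[<] (1 : ℝ))
      (𝓝 (llyCurvature G x y)) := by
  refine tendsto_nhds_limUnder ⟨_, MonotoneOn.tendsto_nhdsWithin_Ioo_left
    (y := 0) ⟨1 / 2, by norm_num⟩ ?_ ?_⟩
  · intro α hα β hβ hαβ
    have hα' : 0 < 1 - α := sub_pos.2 hα.2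
    have hβ' : 0 < 1 - β := sub_pos.2 hβ.2
    have h := mul_ricciCurvature_le G (β := β) (t := (1 - β) / (1 - α)) hα.1.le hα.2.le
      (by positivity) (by rw [div_le_one hα']; linarith) (by field_simp) hxy
    change ricciCurvature G α x y / (1 - α) ≤ ricciCurvature G β x y / (1 - β)
    rw [le_div_iff₀ hβ']
    refine le_trans (le_of_eq ?_) h
    ring
  · refine ⟨2, ?_⟩
    rintro _ ⟨α, hα, rfl⟩
    exact (div_le_iff₀ (sub_pos.2 hα.2)).2 (ricciCurvature_le G hα.1.le hα.2.le hxy)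

/-! ### Curvature of the Cartesian product -/

open scoped Classical in
/-- In a Cartesian product, the lazy measure restricts on the fibre to a multiple of a lazy measure
of the factor, with another laziness. -/
lemma lazyMeasure_boxProd (G : SimpleGraph V) (H : SimpleGraph W)
    [G.LocallyFinite] [H.LocallyFinite] {dG dH : ℕ} (hG : G.IsRegularOfDegree dG)
    (hH : H.IsRegularOfDegree dH) (hdH : 0 < dH) {α β s : ℝ} (hs : 0 ≤ s)
    (hβ : s * α = β) (hβ' : s * (1 - α) = (1 - β) * (dH / (dG + dH))) (x : V) (y : W) :
    lazyMeasure (SimpleGraph.boxProd G H) β (x, y) =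
      fiberMeasure x (fun w => ENNReal.ofReal s * lazyMeasure H α y w)
        (fun v => if G.Adj x v then ENNReal.ofReal ((1 - β) / (dG + dH)) else 0) y := by
  have hdeg : (((SimpleGraph.boxProd G H).degree (x, y) : ℕ) : ℝ) = dG + dH := by
    rw [SimpleGraph.degree_boxProd, hG.degree_eq, hH.degree_eq]
    push_cast
    rfl
  have hdH' : (0 : ℝ) < dH := Nat.cast_pos.2 hdH
  funext ⟨u, w⟩
  by_cases hu : u = x
  · subst hu
    by_cases hw : w = y
    · simp [lazyMeasure, fiberMeasure, hw, ← ENNReal.ofReal_mul hs, hβ]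
    · by_cases ha : H.Adj y w
      · simp only [lazyMeasure, fiberMeasure, Prod.mk.injEq, hw, and_false, if_false, if_true,
          SimpleGraph.boxProd_adj_right, ha, hdeg, hH.degree_eq]
        rw [← ENNReal.ofReal_mul hs, ← mul_div_assoc, hβ']
        congr 1
        field_simp
      · simp [lazyMeasure, fiberMeasure, hw, ha]
  · have hne : (u, w) ≠ (x, y) := fun h => hu (congrArg Prod.fst h)
    have hu' : x ≠ u := fun h => hu h.symm
    simp only [lazyMeasure, fiberMeasure, hne, hu, if_false, SimpleGraph.boxProd_adj, hu',
      and_false, or_false, hdeg]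
    by_cases hw : w = y
    · simp [hw]
    · simp [hw, Ne.symm hw]

theorem ricciCurvature_boxProd (G : SimpleGraph V) (H : SimpleGraph W)
    [G.LocallyFinite] [H.LocallyFinite] {dG dH : ℕ} (hG : G.IsRegularOfDegree dG)
    (hH : H.IsRegularOfDegree dH) {α β s : ℝ} (hs : 0 < s) (hα : 0 ≤ α) (hα1 : α ≤ 1)
    (hβ : s * α = β) (hβ' : s * (1 - α) = (1 - β) * (dH / (dG + dH))) (hβ1 : β ≤ 1)
    (x : V) {y₁ y₂ : W} (hy : H.Adj y₁ y₂) :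
    ricciCurvature (SimpleGraph.boxProd G H) β (x, y₁) (x, y₂) =
      s * ricciCurvature H α y₁ y₂ := by
  classical
  have hdH : 0 < dH := hH.degree_eq y₁ ▸ hy.degree_pos_left
  have hdH' : (0 : ℝ) < dH := Nat.cast_pos.2 hdH
  have hsum : ∑' v, (if G.Adj x v then ENNReal.ofReal ((1 - β) / (dG + dH)) else 0) =
      ENNReal.ofReal (dG * ((1 - β) / (dG + dH))) := by
    rw [tsum_ite_adj, Finset.sum_const, SimpleGraph.card_neighborFinset_eq_degree,
      hG.degree_eq, nsmul_eq_mul, ENNReal.ofReal_mul (Nat.cast_nonneg _),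
      ENNReal.ofReal_natCast]
  have hW := wasserstein_lazyMeasure_ne_top H hα hα1 hy
  rw [ricciCurvature_of_adj _ _ (SimpleGraph.boxProd_adj_right.2 hy),
    ricciCurvature_of_adj _ _ hy, lazyMeasure_boxProd G H hG hH hdH hs.le hβ hβ',
    lazyMeasure_boxProd G H hG hH hdH hs.le hβ hβ',
    wasserstein_fiberMeasure G H x _ _ _ (by simp) (by rw [hsum]; exact ENNReal.ofReal_ne_top) hy,
    wasserstein_const_mul H (by simpa using hs) ENNReal.ofReal_ne_top, hsum,
    ENNReal.toReal_add (ENNReal.mul_ne_top ENNReal.ofReal_ne_top hW) ENNReal.ofReal_ne_top,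
    ENNReal.toReal_mul, ENNReal.toReal_ofReal hs.le, ENNReal.toReal_ofReal]
  · have hs' : s = β + (1 - β) * (dH / (dG + dH)) := by linarith
    have hsplit : (dG : ℝ) * ((1 - β) / (dG + dH)) = 1 - s := by
      rw [hs']
      field_simp
      ring
    rw [hsplit]
    ring
  · have : 0 ≤ 1 - β := sub_nonneg.2 hβ1
    positivity

theorem tendsto_ricciCurvature_boxProd (G : SimpleGraph V) (H : SimpleGraph W)
    [G.LocallyFinite] [H.LocallyFinite] {dG dH : ℕ} (hG : G.IsRegularOfDegree dG)
    (hH : H.IsRegularOfDegree dH) (x : V) {y₁ y₂ : W} (hy : H.Adj y₁ y₂) :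
    Tendsto (fun β : ℝ =>
        ricciCurvature (SimpleGraph.boxProd G H) β (x, y₁) (x, y₂) / (1 - β)) (𝓝[<] (1 : ℝ))
      (𝓝 ((dH : ℝ) / ((dG : ℝ) + (dH : ℝ)) * llyCurvature H y₁ y₂)) := by
  have hdH : (0 : ℝ) < dH := Nat.cast_pos.2 (hH.degree_eq y₁ ▸ hy.degree_pos_left)
  set r : ℝ := (dH : ℝ) / ((dG : ℝ) + (dH : ℝ)) with hr
  have hr0 : 0 < r := by positivity
  have hspos : ∀ β ∈ Set.Ioo (0 : ℝ) 1, 0 < β + (1 - β) * r := fun β hβ =>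
    add_pos hβ.1 (mul_pos (sub_pos.2 hβ.2) hr0)
  have hIoo : Set.Ioo (0 : ℝ) 1 ∈ 𝓝[<] (1 : ℝ) := Ioo_mem_nhdsLT one_pos
  -- The laziness induced on H tends to 1 from below, so the limit in H can be composed with it.
  have hlim : Tendsto (fun β : ℝ => β / (β + (1 - β) * r)) (𝓝[<] (1 : ℝ)) (𝓝[<] (1 : ℝ)) := by
    refine tendsto_nhdsWithin_iff.2 ⟨?_, ?_⟩
    · have hc : ContinuousAt (fun β : ℝ => β / (β + (1 - β) * r)) 1 := by
        refine ContinuousAt.div (by fun_prop) (by fun_prop) (by simp)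
      have := hc.tendsto
      simp only [sub_self, zero_mul, add_zero, div_one] at this
      exact this.mono_left nhdsWithin_le_nhds
    · filter_upwards [hIoo] with β hβ
      exact (div_lt_one (hspos β hβ)).2 (lt_add_of_pos_right _ (mul_pos (sub_pos.2 hβ.2) hr0))
  refine (((tendsto_llyCurvature H hy).comp hlim).const_mul r).congr' ?_
  filter_upwards [hIoo] with β hβ
  have hs := hspos β hβ
  have h1β : 0 < 1 - β := sub_pos.2 hβ.2
  have hα : (β + (1 - β) * r) * (1 - β / (β + (1 - β) * r)) = (1 - β) * r := by
    field_simp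
    ring
  have hα1 : 0 < 1 - β / (β + (1 - β) * r) := by
    rw [← mul_pos_iff_of_pos_left hs, hα]
    positivity
  have key := ricciCurvature_boxProd G H hG hH hs (div_nonneg hβ.1.le hs.le)
    (sub_nonneg.1 hα1.le) (mul_div_cancel₀ _ hs.ne') hα hβ.2.le x hy
  rw [key, Function.comp_apply]
  set a := 1 - β / (β + (1 - β) * r)
  set s := β + (1 - β) * r
  rw [← mul_div_assoc, div_eq_div_iff hα1.ne' h1β.ne']
  linear_combination -ricciCurvature H (β / s) y₁ y₂ * hα

end GraphCurvature

theorem theorem4 {V W : Type*} (G : SimpleGraph V) (H : SimpleGraph W)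
    [G.LocallyFinite] [H.LocallyFinite]
    (dG dH : ℕ) (hG : G.IsRegularOfDegree dG) (hH : H.IsRegularOfDegree dH)
    (x : V) (y₁ y₂ : W) (hy : H.Adj y₁ y₂) :
    (SimpleGraph.boxProd G H).IsRegularOfDegree (dG + dH) ∧
    Tendsto (fun α : ℝ => GraphCurvature.ricciCurvature H α y₁ y₂ / (1 - α)) (𝓝[<] (1 : ℝ))
      (𝓝 (GraphCurvature.llyCurvature H y₁ y₂)) ∧
    Tendsto
      (fun α : ℝ =>
        GraphCurvature.ricciCurvature (SimpleGraph.boxProd G H) α (x, y₁) (x, y₂) / (1 - α))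
      (𝓝[<] (1 : ℝ))
      (𝓝 (GraphCurvature.llyCurvature (SimpleGraph.boxProd G H) (x, y₁) (x, y₂))) ∧
    GraphCurvature.llyCurvature (SimpleGraph.boxProd G H) (x, y₁) (x, y₂) =
      (dH : ℝ) / ((dG : ℝ) + (dH : ℝ)) * GraphCurvature.llyCurvature H y₁ y₂ ∧
    GraphCurvature.ricciCurvature (SimpleGraph.boxProd G H) 0 (x, y₁) (x, y₂) =
      (dH : ℝ) / ((dG : ℝ) + (dH : ℝ)) * GraphCurvature.ricciCurvature H 0 y₁ y₂ := by
  have hadj : (SimpleGraph.boxProd G H).Adj (x, y₁) (x, y₂) := SimpleGraph.boxProd_adj_right.2 hy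
  have hbox := GraphCurvature.tendsto_ricciCurvature_boxProd G H hG hH x hy
  have hdH : (0 : ℝ) < dH := Nat.cast_pos.2 (hH.degree_eq y₁ ▸ hy.degree_pos_left)
  refine ⟨fun p => ?_, GraphCurvature.tendsto_llyCurvature H hy,
    GraphCurvature.tendsto_llyCurvature _ hadj,
    tendsto_nhds_unique (GraphCurvature.tendsto_llyCurvature _ hadj) hbox, ?_⟩
  · rw [SimpleGraph.degree_boxProd, hG.degree_eq, hH.degree_eq]
  -- Here α = β = 0 and s = dH / (dG + dH).
  · exact GraphCurvature.ricciCurvature_boxProd G H hG hH (by positivity) le_rfl zero_le_one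
      (mul_zero _) (by ring) zero_le_one x hy
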